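/- Let $n\ge 2$, $G=GL(n,\mathbb R)$, $K=O(n,\mathbb R)$, let $Z(G)$ be the centre of $G$, and $\mathfrak h^n=G/(K\cdot Z(G))$. For $X\in\mathfrak{gl}(n,\mathbb R)$ let $D_X$ be the operator on $C^\infty(G)$ given by $D_XF(g)=\frac{\partial}{\partial t}F\big(g(I+tX)\big)\big|_{t=0}$, and put $D_{i,j}=D_{E_{i,j}}$, where $E_{i,j}$ is the elementary matrix. The algebra of differential operators generated by the $D_X$ is the universal enveloping algebra $U(\mathfrak{gl}(n,\mathbb R))$; the elements of its centre are called the invariant differential operators. For $1\le m\le n$ the Casimir operator of order $m$ is $$\mathcal D_{m,n}=\sum_{(i_1,\dots,i_m)\in\{1,\dots,n\}^m}D_{i_1,i_2}\circ\cdots\circ D_{i_{m-1},i_m}\circ D_{i_m,i_1},$$ where the operators of a chain are applied in the order in which they are listed ($D_{i_1,i_2}$ first), that is, $$D_{i_1,i_2}\circ\cdots\circ D_{i_m,i_1}F(g)=\frac{\partial^m}{\partial t_1\cdots\partial t_m}F\big(g(I+t_mE_{i_m,i_1})\cdots(I+t_1E_{i_1,i_2})\big)\Big|_{t_1=\cdots=t_m=0}.$$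 For $\nu\in\mathbb C^n$ let $|\cdot|^\nu$ be the power function $|xyk|^\nu=\prod_{i=1}^nY_i^{\nu_i}$, for $x$ upper triangular unipotent, $y=\mathrm{diag}(Y_1,\dots,Y_n)$ with all $Y_i>0$, and $k\in K$; and let $\rho_i=\frac{n+1}2-i$. A Maass form for $SL(n,\mathbb Z)$ is a nonzero smooth function $\phi$ on $\mathfrak h^n$ that is left invariant under $SL(n,\mathbb Z)$, square-integrable on $SL(n,\mathbb Z)\backslash\mathfrak h^n$ for the $G$-invariant measure, cuspidal (for the unipotent radical $U$ of every proper standard parabolic subgroup and every $g$, $\int_{(U\cap SL(n,\mathbb Z))\backslash U}\phi(ug)\,du=0$), and an eigenfunction of every invariant differential operator. It has Langlands parameters $\alpha=(\alpha_1,\dots,\alpha_n)\in\mathbb C^n$ if $\sum_\ell\alpha_\ell=0$ and every invariant differential operator has the same eigenvalue on $\phi$ as on $|\cdot|^{\alpha+\rho}$. **Theorem 1.1.** Let $1\le m\le n$, and let $\phi$ be a Maass form for $SL(n,\mathbb Z)$ with Langlands parameters $(\alpha_1,\dots,\alpha_n)\in\mathbb C^n$. Then $$\mathcal D_{m,n}\phi=\begin{cases}0&\text{if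 }m=1,\\[2pt]\Big(\sum_{\ell=1}^n\alpha_\ell^2-\frac{n^3-n}{12}\Big)\phi&\text{if }m=2,\\[2pt]\Big(\sum_{\ell=1}^n\alpha_\ell^3-\frac n2\sum_{\ell=1}^n\alpha_\ell^2+\frac{n^4-n^2}{24}\Big)\phi&\text{if }m=3,\\[2pt]\Big(\sum_{\ell=1}^n\alpha_\ell^4-n\sum_{\ell=1}^n\alpha_\ell^3+\frac12\sum_{\ell=1}^n\alpha_\ell^2-\frac{n^5-n}{80}\Big)\phi&\text{if }m=4.\end{cases}$$ -/

import Mathlib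

open Matrix MeasureTheory
open scoped MatrixGroups ContDiff

noncomputable section

namespace GLMaass

/-! ### Smooth functions on `GL(n, ℝ)` -/

/-- The open set `GL(n, ℝ)` inside the coordinate space `ℝ^(n × n)`. -/
def invertibleSet (n : ℕ) : Set (Fin n → Fin n → ℝ) :=
  {A | (Matrix.of A).det ≠ 0}

/-- A function on `GL(n, ℝ)` as a function of the `n²` matrix entries
(the value `0` is used at singular matrices and never matters). -/
def inCoords {n : ℕ} (F : GL (Fin n) ℝ → ℂ) : (Fin n → Fin n → ℝ) → ℂ :=
  fun A => Function.extend (fun g : GL (Fin n) ℝ => (g : Matrix (Fin n) (Fin n) ℝ)) F 0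
    (Matrix.of A)

lemma inCoords_coe {n : ℕ} (F : GL (Fin n) ℝ → ℂ) (g : GL (Fin n) ℝ) :
    inCoords F (fun a b => (g : Matrix (Fin n) (Fin n) ℝ) a b) = F g :=
  Function.Injective.extend_apply Units.val_injective F 0 g

lemma isOpen_invertibleSet (n : ℕ) : IsOpen (invertibleSet n) := by
  have h : Continuous fun A : Fin n → Fin n → ℝ => (Matrix.of A).det :=
    Continuous.matrix_det (continuous_id)
  exact isOpen_ne.preimage h

lemma coe_mem_invertibleSet {n : ℕ} (g : GL (Fin n) ℝ) :
    (fun a b => (g : Matrix (Fin n) (Fin n) ℝ) a b) ∈ invertibleSet n :=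
  Matrix.GeneralLinearGroup.det_ne_zero g

lemma exists_coe_of_mem {n : ℕ} {A : Fin n → Fin n → ℝ} (hA : A ∈ invertibleSet n) :
    ∃ g : GL (Fin n) ℝ, (fun a b => (g : Matrix (Fin n) (Fin n) ℝ) a b) = A :=
  ⟨Matrix.GeneralLinearGroup.mkOfDetNeZero (Matrix.of A) hA, rfl⟩

/-- The space `C^∞(GL(n, ℝ))` of smooth complex-valued functions on `GL(n, ℝ)`. -/
def SmoothFn (n : ℕ) : Submodule ℂ (GL (Fin n) ℝ → ℂ) where
  carrier := {F | ContDiffOn ℝ ∞ (inCoords F) (invertibleSet n)}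
  zero_mem' := by
    refine (contDiffOn_const (c := (0 : ℂ))).congr fun A hA => ?_
    obtain ⟨g, rfl⟩ := exists_coe_of_mem hA
    rw [inCoords_coe]; rfl
  add_mem' := by
    intro F G hF hG
    refine (ContDiffOn.add hF hG).congr fun A hA => ?_
    obtain ⟨g, rfl⟩ := exists_coe_of_mem hA
    simp only [inCoords_coe, Pi.add_apply]
  smul_mem' := by
    intro c F hF
    refine (ContDiffOn.const_smul c hF).congr fun A hA => ?_
    obtain ⟨g, rfl⟩ := exists_coe_of_mem hA
    simp only [inCoords_coe, Pi.smul_apply]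

/-! ### Invariant differential operators -/

/-- `(D_X F)(g) = d/dt F(g (1 + t X))` at `t = 0`. -/
def rightDeriv {n : ℕ} (X : Matrix (Fin n) (Fin n) ℝ) (F : GL (Fin n) ℝ → ℂ) :
    GL (Fin n) ℝ → ℂ :=
  fun g => deriv (fun t : ℝ =>
    inCoords F (fun a b => ((g : Matrix (Fin n) (Fin n) ℝ) * (1 + t • X)) a b)) 0

/-- Right multiplication by `X` on matrix entries, as a continuous linear map. -/
def mulRightCLM {n : ℕ} (X : Matrix (Fin n) (Fin n) ℝ) :
    (Fin n → Fin n → ℝ) →L[ℝ] (Fin n → Fin n → ℝ) :=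
  LinearMap.toContinuousLinearMap
    { toFun := fun A a b => (Matrix.of A * X) a b
      map_add' := by
        intro A B; ext a b; simp [Matrix.mul_apply, add_mul, Finset.sum_add_distrib]
      map_smul' := by
        intro c A; ext a b; simp [Matrix.mul_apply, mul_assoc, Finset.mul_sum] }

lemma hasDerivAt_inCoords {n : ℕ} (X : Matrix (Fin n) (Fin n) ℝ) {F : GL (Fin n) ℝ → ℂ}
    (hF : F ∈ SmoothFn n) (g : GL (Fin n) ℝ) :
    HasDerivAt (fun t : ℝ =>
        inCoords F (fun a b => ((g : Matrix (Fin n) (Fin n) ℝ) * (1 + t • X)) a b))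
      (fderiv ℝ (inCoords F) (fun a b => (g : Matrix (Fin n) (Fin n) ℝ) a b)
        (mulRightCLM X (fun a b => (g : Matrix (Fin n) (Fin n) ℝ) a b))) 0 := by
  set A : Fin n → Fin n → ℝ := fun a b => (g : Matrix (Fin n) (Fin n) ℝ) a b with hA
  have hcurve : ∀ t : ℝ,
      (fun a b => ((g : Matrix (Fin n) (Fin n) ℝ) * (1 + t • X)) a b) =
        A + t • mulRightCLM X A := by
    intro t; ext a b
    simp only [Matrix.mul_add, Matrix.mul_one, Matrix.mul_smul]
    rfl
  simp only [hcurve]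
  have hd : HasFDerivAt (inCoords F) (fderiv ℝ (inCoords F) A) (A + (0 : ℝ) • mulRightCLM X A) := by
    rw [zero_smul, add_zero]
    exact ((ContDiffOn.contDiffAt hF ((isOpen_invertibleSet n).mem_nhds
      (coe_mem_invertibleSet g))).differentiableAt (by simp)).hasFDerivAt
  have hc : HasDerivAt (fun t : ℝ => A + t • mulRightCLM X A) (mulRightCLM X A) 0 := by
    simpa using ((hasDerivAt_id (0 : ℝ)).smul_const (mulRightCLM X A)).const_add A
  exact hd.comp_hasDerivAt (0 : ℝ) hc

lemma rightDeriv_eq {n : ℕ} (X : Matrix (Fin n) (Fin n) ℝ) {F : GL (Fin n) ℝ → ℂ}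
    (hF : F ∈ SmoothFn n) (g : GL (Fin n) ℝ) :
    rightDeriv X F g = fderiv ℝ (inCoords F) (fun a b => (g : Matrix (Fin n) (Fin n) ℝ) a b)
        (mulRightCLM X (fun a b => (g : Matrix (Fin n) (Fin n) ℝ) a b)) :=
  (hasDerivAt_inCoords X hF g).deriv

lemma rightDeriv_mem {n : ℕ} (X : Matrix (Fin n) (Fin n) ℝ) {F : GL (Fin n) ℝ → ℂ}
    (hF : F ∈ SmoothFn n) : rightDeriv X F ∈ SmoothFn n := by
  have h1 : ContDiffOn ℝ ∞ (fderiv ℝ (inCoords F)) (invertibleSet n) :=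
    ContDiffOn.fderiv_of_isOpen hF (isOpen_invertibleSet n) (by simp)
  refine (h1.clm_apply (mulRightCLM X).contDiff.contDiffOn).congr fun A hA => ?_
  obtain ⟨g, rfl⟩ := exists_coe_of_mem hA
  rw [inCoords_coe, rightDeriv_eq X hF]

lemma eventually_mem_invertibleSet {n : ℕ} (X : Matrix (Fin n) (Fin n) ℝ) (g : GL (Fin n) ℝ) :
    ∀ᶠ t : ℝ in nhds 0,
      (fun a b => ((g : Matrix (Fin n) (Fin n) ℝ) * (1 + t • X)) a b) ∈ invertibleSet n := by
  have hcont : Continuous fun t : ℝ =>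
      (fun a b => ((g : Matrix (Fin n) (Fin n) ℝ) * (1 + t • X)) a b) := by
    refine continuous_pi fun a => continuous_pi fun b => ?_
    simp only [Matrix.mul_add, Matrix.mul_one, Matrix.mul_smul, Matrix.add_apply,
      Matrix.smul_apply, smul_eq_mul]
    fun_prop
  refine hcont.continuousAt.eventually_mem ((isOpen_invertibleSet n).mem_nhds ?_)
  simpa using coe_mem_invertibleSet g

/-- The differential operator `D_X` on smooth functions on `GL(n, ℝ)`. -/
def diffOp {n : ℕ} (X : Matrix (Fin n) (Fin n) ℝ) : Module.End ℂ (SmoothFn n) where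
  toFun F := ⟨rightDeriv X F, rightDeriv_mem X F.2⟩
  map_add' := by
    intro F G
    ext g
    have h := (hasDerivAt_inCoords X F.2 g).add (hasDerivAt_inCoords X G.2 g)
    change rightDeriv X (F + G : SmoothFn n) g = rightDeriv X F g + rightDeriv X G g
    rw [rightDeriv_eq X F.2, rightDeriv_eq X G.2, ← h.deriv]
    refine Filter.EventuallyEq.deriv_eq ?_
    filter_upwards [eventually_mem_invertibleSet X g] with t ht
    obtain ⟨g', hg'⟩ := exists_coe_of_mem ht
    simp only [Pi.add_apply]
    rw [← hg', inCoords_coe, inCoords_coe, inCoords_coe]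
    rfl
  map_smul' := by
    intro c F
    ext g
    have h := (hasDerivAt_inCoords X F.2 g).const_smul c
    change rightDeriv X (c • F : SmoothFn n) g = c • rightDeriv X F g
    rw [rightDeriv_eq X F.2, ← h.deriv]
    refine Filter.EventuallyEq.deriv_eq ?_
    filter_upwards [eventually_mem_invertibleSet X g] with t ht
    obtain ⟨g', hg'⟩ := exists_coe_of_mem ht
    simp only [Pi.smul_apply]
    rw [← hg', inCoords_coe, inCoords_coe]
    rfl

/-- The universal enveloping algebra `U(𝔤𝔩(n, ℝ))`, realised as the associative `ℝ`-algebra of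
differential operators on `C^∞(GL(n, ℝ))` generated by the `D_X`, `X ∈ 𝔤𝔩(n, ℝ)`. -/
def envelopingAlg (n : ℕ) : Subalgebra ℝ (Module.End ℂ (SmoothFn n)) :=
  Algebra.adjoin ℝ (Set.range fun X : Matrix (Fin n) (Fin n) ℝ => diffOp X)

/-- The invariant differential operators: the centre `Z(U(𝔤𝔩(n, ℝ)))`. -/
def invariantOps (n : ℕ) : Subalgebra ℝ (Module.End ℂ (SmoothFn n)) :=
  envelopingAlg n ⊓ Subalgebra.centralizer ℝ (envelopingAlg n : Set (Module.End ℂ (SmoothFn n)))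

/-- `D_{i_1,i_2} ∘ ⋯ ∘ D_{i_{m-1},i_m} ∘ D_{i_m,i_1}`, where `D_{i,j} = D_{E_{i,j}}` and the
operators of the chain act one after the other in the order in which they are listed, that is,
its value at `F` and `g` is
`∂^m/∂t_1⋯∂t_m F(g (1 + t_m E_{i_m,i_1}) ⋯ (1 + t_2 E_{i_2,i_3}) (1 + t_1 E_{i_1,i_2}))` at `0`.
A product in `Module.End` applies its right-most factor first, whence the reversal of the list.
Here `finRotate m j` is the cyclic successor of the index `j`. -/
def elementaryOp {m n : ℕ} (i : Fin m → Fin n) : Module.End ℂ (SmoothFn n) :=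
  ((List.ofFn fun j : Fin m =>
    diffOp (Matrix.single (i j) (i (finRotate m j)) (1 : ℝ))).reverse).prod

/-- The Casimir operator `𝒟_{m,n}` of order `m` for `GL(n, ℝ)`. -/
def casimir (m n : ℕ) : Module.End ℂ (SmoothFn n) :=
  ∑ i : Fin m → Fin n, elementaryOp i

/-! ### The power function -/

/-- An upper triangular matrix with ones on the diagonal. -/
def IsUpperUnipotent {n : ℕ} (x : Matrix (Fin n) (Fin n) ℝ) : Prop :=
  (∀ i, x i i = 1) ∧ ∀ i j, j < i → x i j = 0

/-- The lower right minor of `A Aᵀ` on the rows and columns `i, i+1, …` (counted from `0`). -/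
def cornerMinor {n : ℕ} (A : Matrix (Fin n) (Fin n) ℝ) (i : ℕ) : ℝ :=
  ((A * Aᵀ).submatrix (Subtype.val : {j : Fin n // i ≤ j.val} → Fin n) Subtype.val).det

/-- The diagonal entry `Y_i > 0` in the Iwasawa decomposition `A = x · diag(Y) · k` with `x` upper
triangular unipotent and `k` orthogonal; see `iwasawaY_eq`. -/
def iwasawaY {n : ℕ} (A : Matrix (Fin n) (Fin n) ℝ) (i : Fin n) : ℝ :=
  √(cornerMinor A i / cornerMinor A (i + 1))

/-- The power function `|x · diag(Y) · k|^ν = ∏ Y_i ^ ν_i`. -/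
def powerFun {n : ℕ} (ν : Fin n → ℂ) (g : GL (Fin n) ℝ) : ℂ :=
  ∏ i, (iwasawaY (g : Matrix (Fin n) (Fin n) ℝ) i : ℂ) ^ ν i

lemma cornerMinor_pos {n : ℕ} {A : Matrix (Fin n) (Fin n) ℝ} (hA : A.det ≠ 0) (i : ℕ) :
    0 < cornerMinor A i := by
  have hpd : (A * Aᵀ).PosDef := by
    have := Matrix.PosDef.mul_conjTranspose_self A
      (Matrix.vecMul_injective_iff_isUnit.mpr
        ((Matrix.isUnit_iff_isUnit_det A).mpr (isUnit_iff_ne_zero.mpr hA)))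
    simpa using this
  exact (hpd.submatrix Subtype.val_injective).det_pos

lemma cornerMinor_iwasawa {n : ℕ} {x k : Matrix (Fin n) (Fin n) ℝ} {Y : Fin n → ℝ}
    (hx : IsUpperUnipotent x) (hk : k ∈ Matrix.orthogonalGroup (Fin n) ℝ) (i : ℕ) :
    cornerMinor (x * Matrix.diagonal Y * k) i = ∏ j : {j : Fin n // i ≤ j.val}, Y j ^ 2 := by
  have hkk : k * kᵀ = 1 := by
    simpa [Matrix.star_eq_conjTranspose] using (Matrix.mem_unitaryGroup_iff.mp hk)
  have h1 : (x * Matrix.diagonal Y * k) * (x * Matrix.diagonal Y * k)ᵀ =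
      x * Matrix.diagonal (fun j => Y j ^ 2) * xᵀ := by
    have : (x * Matrix.diagonal Y * k) * (x * Matrix.diagonal Y * k)ᵀ =
        x * (Matrix.diagonal Y * (k * kᵀ) * Matrix.diagonal Y) * xᵀ := by
      simp only [Matrix.transpose_mul, Matrix.diagonal_transpose, Matrix.mul_assoc]
    rw [this, hkk, Matrix.mul_one, Matrix.diagonal_mul_diagonal]
    simp only [sq]
  set e : {j : Fin n // i ≤ j.val} → Fin n := Subtype.val with he
  have h2 : (x * Matrix.diagonal (fun j => Y j ^ 2) * xᵀ).submatrix e e =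
      x.submatrix e e * Matrix.diagonal (fun j => Y (e j) ^ 2) * (x.submatrix e e)ᵀ := by
    ext a b
    rw [Matrix.submatrix_apply, Matrix.mul_apply, Matrix.mul_apply]
    simp only [Matrix.mul_diagonal, Matrix.transpose_apply, Matrix.submatrix_apply]
    symm
    refine Finset.sum_of_injOn e Subtype.val_injective.injOn (fun _ _ => Finset.mem_univ _) ?_
      fun _ _ => rfl
    intro j _ hj
    have hji : j < e a := by
      by_contra hlt
      exact hj ⟨⟨j, le_trans a.2 (not_lt.mp hlt)⟩, by simp, rfl⟩
    rw [hx.2 _ _ hji, zero_mul, zero_mul]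
  have h3 : (x.submatrix e e).det = 1 := by
    rw [Matrix.det_of_isUpperTriangular]
    · exact Finset.prod_eq_one fun j _ => hx.1 _
    · intro a b hab
      exact hx.2 _ _ hab
  rw [cornerMinor, h1, h2, Matrix.det_mul, Matrix.det_mul, Matrix.det_transpose, h3,
    Matrix.det_diagonal]
  simp [he]

/-- `iwasawaY` is the diagonal part of the Iwasawa decomposition. -/
theorem iwasawaY_eq {n : ℕ} {x k : Matrix (Fin n) (Fin n) ℝ} {Y : Fin n → ℝ}
    (hx : IsUpperUnipotent x) (hY : ∀ i, 0 < Y i)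
    (hk : k ∈ Matrix.orthogonalGroup (Fin n) ℝ) :
    iwasawaY (x * Matrix.diagonal Y * k) = Y := by
  funext i
  have key : ∏ j : {j : Fin n // (i : ℕ) ≤ j.val}, Y j ^ 2 =
      Y i ^ 2 * ∏ j : {j : Fin n // (i : ℕ) + 1 ≤ j.val}, Y j ^ 2 := by
    rw [← Finset.prod_subtype (Finset.univ.filter fun j : Fin n => (i : ℕ) ≤ j.val)
        (by simp) (fun j => Y j ^ 2),
      ← Finset.prod_subtype (Finset.univ.filter fun j : Fin n => (i : ℕ) + 1 ≤ j.val)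
        (by simp) (fun j => Y j ^ 2),
      ← Finset.prod_insert (f := fun j => Y j ^ 2) (a := i)
        (s := Finset.univ.filter fun j : Fin n => (i : ℕ) + 1 ≤ j.val) (by simp)]
    refine Finset.prod_congr ?_ fun _ _ => rfl
    ext j
    simp only [Finset.mem_filter, Finset.mem_univ, true_and, Finset.mem_insert, Fin.ext_iff]
    omega
  have hpos : 0 < ∏ j : {j : Fin n // (i : ℕ) + 1 ≤ j.val}, Y j ^ 2 :=
    Finset.prod_pos fun j _ => pow_pos (hY _) 2
  rw [iwasawaY, cornerMinor_iwasawa hx hk, cornerMinor_iwasawa hx hk, key,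
    mul_div_cancel_right₀ _ hpos.ne', Real.sqrt_sq (hY i).le]

theorem powerFun_iwasawa {n : ℕ} (ν : Fin n → ℂ) {x k : Matrix (Fin n) (Fin n) ℝ}
    {Y : Fin n → ℝ} (hx : IsUpperUnipotent x) (hY : ∀ i, 0 < Y i)
    (hk : k ∈ Matrix.orthogonalGroup (Fin n) ℝ) (g : GL (Fin n) ℝ)
    (hg : (g : Matrix (Fin n) (Fin n) ℝ) = x * Matrix.diagonal Y * k) :
    powerFun ν g = ∏ i, (Y i : ℂ) ^ ν i := by
  rw [powerFun, hg, iwasawaY_eq hx hY hk]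

lemma contDiff_cornerMinor (n i : ℕ) :
    ContDiff ℝ ∞ fun A : Fin n → Fin n → ℝ => cornerMinor (Matrix.of A) i := by
  unfold cornerMinor
  simp only [Matrix.det_apply, Matrix.submatrix_apply, Matrix.mul_apply, Matrix.transpose_apply,
    Matrix.of_apply]
  fun_prop

lemma powerFun_mem {n : ℕ} (ν : Fin n → ℂ) : powerFun ν ∈ SmoothFn n := by
  have h : ContDiffOn ℝ ∞ (fun A : Fin n → Fin n → ℝ =>
      ∏ i, Complex.exp ((Real.log (iwasawaY (Matrix.of A) i) : ℂ) * ν i)) (invertibleSet n) := by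
    refine contDiffOn_prod fun i _ => ?_
    refine ContDiffOn.cexp (ContDiffOn.mul ?_ contDiffOn_const)
    refine Complex.ofRealCLM.contDiff.comp_contDiffOn ?_
    have hq : ∀ A ∈ invertibleSet n,
        cornerMinor (Matrix.of A) i / cornerMinor (Matrix.of A) (i + 1) ≠ 0 := fun A hA =>
      (div_pos (cornerMinor_pos hA _) (cornerMinor_pos hA _)).ne'
    refine ContDiffOn.log (ContDiffOn.sqrt (ContDiffOn.div
      (contDiff_cornerMinor n i).contDiffOn (contDiff_cornerMinor n (i + 1)).contDiffOn
      fun A hA => (cornerMinor_pos hA _).ne') hq) fun A hA => ?_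
    exact (Real.sqrt_pos.mpr (div_pos (cornerMinor_pos hA _) (cornerMinor_pos hA _))).ne'
  refine h.congr fun A hA => ?_
  obtain ⟨g, rfl⟩ := exists_coe_of_mem hA
  rw [inCoords_coe]
  refine Finset.prod_congr rfl fun i _ => ?_
  have hp : 0 < iwasawaY (g : Matrix (Fin n) (Fin n) ℝ) i :=
    Real.sqrt_pos.mpr (div_pos (cornerMinor_pos (Matrix.GeneralLinearGroup.det_ne_zero g) _)
      (cornerMinor_pos (Matrix.GeneralLinearGroup.det_ne_zero g) _))
  rw [Complex.cpow_def_of_ne_zero (by exact_mod_cast hp.ne'), ← Complex.ofReal_log hp.le]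
  rfl

/-- The power function as an element of `C^∞(GL(n, ℝ))`. -/
def power {n : ℕ} (ν : Fin n → ℂ) : SmoothFn n := ⟨powerFun ν, powerFun_mem ν⟩

/-- The shift `ρ_i = (n + 1) / 2 - i` for `i = 1, …, n` (here indices start at `0`). -/
def rhoShift (n : ℕ) (i : Fin n) : ℂ := ((n : ℂ) + 1) / 2 - ((i : ℕ) + 1 : ℂ)

/-! ### Maass forms -/

/-- The image of `SL(n, ℤ)` in `SL(n, ℝ)`. -/
def gammaSL (n : ℕ) : Subgroup (SpecialLinearGroup (Fin n) ℝ) :=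
  (SpecialLinearGroup.map (Int.castRingHom ℝ)).range

/-- The Borel `σ`-algebra of `SL(n, ℝ)`. -/
instance instMeasurableSpaceSL (n : ℕ) : MeasurableSpace (SpecialLinearGroup (Fin n) ℝ) :=
  borel _

/-- Square-integrability on `SL(n, ℤ) \ 𝔥ⁿ`. Since `𝔥ⁿ = SL(n, ℝ) / SO(n)` with `SO(n)` compact,
this is square-integrability on `SL(n, ℤ) \ SL(n, ℝ)` for Haar measure, and it is tested on a
fundamental domain for left multiplication by `SL(n, ℤ)`. -/
def IsSquareIntegrable {n : ℕ} (φ : GL (Fin n) ℝ → ℂ) : Prop :=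
  ∃ (μ : Measure (SpecialLinearGroup (Fin n) ℝ)) (S : Set (SpecialLinearGroup (Fin n) ℝ)),
    μ.IsHaarMeasure ∧ IsFundamentalDomain (gammaSL n) S μ ∧
      MemLp (fun g : SpecialLinearGroup (Fin n) ℝ => φ (SpecialLinearGroup.toGL g)) 2
        (μ.restrict S)

/-- The element with entries `u_{ij}` for `b i < b j` of the unipotent radical of the standard
parabolic subgroup whose blocks are the fibres of the monotone map `b`. -/
def blockUnipotent {n : ℕ} (b : Fin n →o ℕ) (u : Fin n → Fin n → ℝ) :
    Matrix (Fin n) (Fin n) ℝ :=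
  1 + Matrix.of fun i j => if b i < b j then u i j else 0

lemma det_blockUnipotent {n : ℕ} (b : Fin n →o ℕ) (u : Fin n → Fin n → ℝ) :
    (blockUnipotent b u).det ≠ 0 := by
  rw [Matrix.det_of_isUpperTriangular]
  · simp [blockUnipotent]
  · intro i j hij
    have hij' : j < i := hij
    have hb : ¬ b i < b j := not_lt.mpr (b.monotone hij'.le)
    simp [blockUnipotent, hb, hij'.ne']

/-- Cuspidality: for the unipotent radical `U` of every proper standard parabolic subgroup and
every `g`, the integral of `φ(u g)` over `(U ∩ SL(n, ℤ)) \ U` vanishes. The unit cube is a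
fundamental domain of that quotient; the entries `u_{ij}` with `b i ≥ b j` do not occur in the
integrand. -/
def IsCuspidal {n : ℕ} (φ : GL (Fin n) ℝ → ℂ) : Prop :=
  ∀ b : Fin n →o ℕ, (∃ i j, b i ≠ b j) → ∀ g : GL (Fin n) ℝ,
    ∫ u in Set.Icc (0 : Fin n → Fin n → ℝ) 1,
      φ (Matrix.GeneralLinearGroup.mkOfDetNeZero (blockUnipotent b u)
        (det_blockUnipotent b u) * g) = 0

/-- A Maass form for `SL(n, ℤ)`: a nonzero smooth function on
`𝔥ⁿ = GL(n, ℝ) / (O(n, ℝ) · Z(GL(n, ℝ)))`, given as a function on `GL(n, ℝ)`, which is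
`SL(n, ℤ)`-invariant, square-integrable modulo `SL(n, ℤ)`, cuspidal, and an eigenfunction of all
invariant differential operators. -/
structure IsMaassForm {n : ℕ} (φ : SmoothFn n) : Prop where
  ne_zero : φ ≠ 0
  left_invariant : ∀ (γ : SpecialLinearGroup (Fin n) ℤ) (g : GL (Fin n) ℝ),
    (φ : GL (Fin n) ℝ → ℂ)
      (SpecialLinearGroup.toGL (SpecialLinearGroup.map (Int.castRingHom ℝ) γ) * g) =
    (φ : GL (Fin n) ℝ → ℂ) g
  right_orthogonal : ∀ k : GL (Fin n) ℝ,
    (k : Matrix (Fin n) (Fin n) ℝ) ∈ Matrix.orthogonalGroup (Fin n) ℝ →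
    ∀ g, (φ : GL (Fin n) ℝ → ℂ) (g * k) = (φ : GL (Fin n) ℝ → ℂ) g
  right_center : ∀ z ∈ Subgroup.center (GL (Fin n) ℝ),
    ∀ g, (φ : GL (Fin n) ℝ → ℂ) (g * z) = (φ : GL (Fin n) ℝ → ℂ) g
  square_integrable : IsSquareIntegrable (φ : GL (Fin n) ℝ → ℂ)
  cuspidal : IsCuspidal (φ : GL (Fin n) ℝ → ℂ)
  eigenfunction : ∀ D ∈ invariantOps n, ∃ c : ℂ, D φ = c • φ

/-- `φ` has Langlands parameters `α`: they sum to zero, and every invariant differential operator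
acts on `φ` with the same eigenvalue as on the power function with parameters `α + ρ`. -/
def HasLanglandsParameters {n : ℕ} (φ : SmoothFn n) (α : Fin n → ℂ) : Prop :=
  ∑ i, α i = 0 ∧ ∀ D ∈ invariantOps n, ∀ c : ℂ,
    D (power fun i => α i + rhoShift n i) = c • power (fun i => α i + rhoShift n i) →
      D φ = c • φ

end GLMaass

end

/-! Collect the generators in a matrix `E` of operators with (i, j) entry D_{j,i}. The transposition
absorbs the reversal in the chains, so the Casimir operator is the trace of `E ^ m`
(`casimir_eq_trace`). Entries of `E ^ m` behave under commutators like those of `E`, so this trace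
is central (`IsGLMatrix.commute_trace_pow`), and by the definition of Langlands parameters its
eigenvalue can be read off on the power function with exponent ν = α + ρ.

That function is equivariant under upper triangular matrices on the left, while D_X differentiates
on the right. At a point g, the operator D_{g⁻¹Xg} is the derivative along left translation by X.
Replacing every D_X by D_{g⁻¹Xg} conjugates `E` by the real matrix g and preserves the traces of
powers (`trace_conjGenerators_pow`). Evaluation at g then becomes a highest weight functional: the
entries of `E` below the diagonal are killed, and the i-th diagonal entry acts by ν_i.

Commuting the vanishing entries to the left (`IsGLMatrix.pow_apply_of_highestWeight`) turns the
trace into the sum of the entries of Aᵐ applied to the all-ones vector, where A is upper triangular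
with ones above the diagonal and diagonal a_k = ν_k - #{j > k} = α_k - (n-1)/2. Newton-type
identities for these sums (`sum_diagEigenvalue`) yield the stated polynomials. -/

namespace GLMaass

/-! ### Matrices over the enveloping algebra -/

section Commutator

variable {n : ℕ} {R : Type*} [Ring R]

/-- The commutation relations satisfied by the matrix of (transposed) elementary generators
of `𝔤𝔩(n)`. -/
def IsGLMatrix (E : Matrix (Fin n) (Fin n) R) : Prop :=
  ∀ i j k l, E i j * E k l - E k l * E i j =
    (if i = l then E k j else 0) - (if j = k then E i l else 0)

/-- Commutation with `E i j` is a derivation. In the Leibniz expansion of `E ^ p * E` the two terms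
coming from the summed inner index cancel, and only the outer indices contribute. -/
lemma IsGLMatrix.pow_commutator {E : Matrix (Fin n) (Fin n) R} (hE : IsGLMatrix E) (p : ℕ)
    (i j k l : Fin n) :
    E i j * (E ^ p) k l - (E ^ p) k l * E i j =
      (if i = l then (E ^ p) k j else 0) - (if j = k then (E ^ p) i l else 0) := by
  induction p generalizing k l with
  | zero =>
    simp only [pow_zero, Matrix.one_apply]
    by_cases h1 : i = l <;> by_cases h2 : j = k <;> by_cases h3 : k = l <;> simp_all [eq_comm]
  | succ p ih =>
    have hstep : ∀ k l, (E ^ (p + 1)) k l = ∑ a, (E ^ p) k a * E a l := fun k l => by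
      rw [pow_succ, Matrix.mul_apply]
    have hterm : ∀ a, E i j * ((E ^ p) k a * E a l) - (E ^ p) k a * E a l * E i j =
        ((if i = a then (E ^ p) k j else 0) - (if j = k then (E ^ p) i a else 0)) * E a l +
        (E ^ p) k a * ((if i = l then E a j else 0) - (if j = a then E i l else 0)) := fun a => by
      rw [← ih, ← hE]; noncomm_ring
    rw [hstep k l, Finset.mul_sum, Finset.sum_mul, ← Finset.sum_sub_distrib]
    simp only [hterm, sub_mul, mul_sub, Finset.sum_add_distrib, Finset.sum_sub_distrib, ite_mul,
      mul_ite, zero_mul, mul_zero, Finset.sum_ite_eq, Finset.mem_univ, if_true, hstep]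
    split_ifs <;> simp
    abel

/-- After setting k = l and summing, both terms of `pow_commutator` equal `(E ^ p) i j`. -/
lemma IsGLMatrix.commute_trace_pow {E : Matrix (Fin n) (Fin n) R} (hE : IsGLMatrix E) (p : ℕ)
    (i j : Fin n) : Commute (E i j) (E ^ p).trace := by
  have h : E i j * (E ^ p).trace - (E ^ p).trace * E i j = 0 := by
    simp only [Matrix.trace, Matrix.diag_apply, Finset.mul_sum, Finset.sum_mul,
      ← Finset.sum_sub_distrib, hE.pow_commutator]
    simp
  exact sub_eq_zero.mp h

end Commutator

/-! ### Highest weight vectors -/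

/-- The eigenvalues of the diagonal entries of the powers of the generator matrix. -/
def diagEigenvalue {n : ℕ} (a : Fin n → ℂ) : ℕ → Fin n → ℂ
  | 0, _ => 1
  | p + 1, k => a k * diagEigenvalue a p k + ∑ j, if k < j then diagEigenvalue a p j else 0

lemma matrix_pow_apply_mem {n : ℕ} {M : Type*} [AddCommGroup M] [Module ℂ M]
    {E : Matrix (Fin n) (Fin n) (Module.End ℂ M)} {V : Submodule ℂ M}
    (hV : ∀ i j, ∀ v ∈ V, E i j v ∈ V) (p : ℕ) (k l : Fin n) :
    ∀ v ∈ V, (E ^ p) k l v ∈ V := by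
  induction p generalizing l with
  | zero =>
    intro v hv
    rw [pow_zero, Matrix.one_apply]
    split_ifs
    · exact hv
    · exact V.zero_mem
  | succ p ih =>
    intro v hv
    rw [pow_succ, Matrix.mul_apply, LinearMap.sum_apply]
    exact V.sum_mem fun a _ => ih a _ (hV a l v hv)

/-- The functional `ev` plays the role of a highest weight vector in the dual of `V`: the leftmost
operator meets it first. The vanishing below the diagonal is carried along because the diagonal
recursion needs it. -/
lemma IsGLMatrix.pow_apply_of_highestWeight {n : ℕ} {M : Type*} [AddCommGroup M] [Module ℂ M]
    {E : Matrix (Fin n) (Fin n) (Module.End ℂ M)} (hE : IsGLMatrix E) {V : Submodule ℂ M}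
    (hV : ∀ i j, ∀ v ∈ V, E i j v ∈ V) (ev : M →ₗ[ℂ] ℂ) (ν : Fin n → ℂ)
    (hlow : ∀ i j, j < i → ∀ v ∈ V, ev (E i j v) = 0)
    (hdiag : ∀ i, ∀ v ∈ V, ev (E i i v) = ν i * ev v) (p : ℕ) :
    (∀ k l, l < k → ∀ v ∈ V, ev ((E ^ p) k l v) = 0) ∧
    ∀ k, ∀ v ∈ V, ev ((E ^ p) k k v) =
      diagEigenvalue (fun k => ν k - ((n : ℂ) - 1 - (k : ℕ))) p k * ev v := by
  induction p with
  | zero =>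
    refine ⟨fun k l hkl v _ => ?_, fun k v _ => ?_⟩
    · simp [Matrix.one_apply_ne hkl.ne']
    · simp [diagEigenvalue]
  | succ p ih =>
    obtain ⟨ih1, ih2⟩ := ih
    have hstep : ∀ k l v, ev ((E ^ (p + 1)) k l v) = ∑ j, ev ((E ^ p) k j (E j l v)) :=
      fun k l v => by
        rw [pow_succ, Matrix.mul_apply, LinearMap.sum_apply, map_sum]; rfl
    -- Moving `E j l` with l < j to the left brings it next to `ev`, which kills it; only the
    -- commutator remains.
    have hcomm : ∀ k l j, l < j → ∀ v ∈ V, ev ((E ^ p) k j (E j l v)) =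
        (if k = l then ev ((E ^ p) j j v) else 0) - ev ((E ^ p) k l v) := by
      intro k l j hlj v hv
      have h := congrArg (fun T : Module.End ℂ M => ev (T v)) (hE.pow_commutator p j l k j)
      simp only [LinearMap.sub_apply, Module.End.mul_apply, map_sub, if_true] at h
      rw [hlow j l hlj _ (matrix_pow_apply_mem hV p k j v hv)] at h
      by_cases hkl : k = l
      · subst hkl
        simp only [if_true] at h ⊢
        linear_combination -h
      · simp only [hkl, Ne.symm hkl, if_false, LinearMap.zero_apply, map_zero] at h ⊢
        linear_combination -h
    constructor
    · intro k l hkl v hv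
      rw [hstep]
      refine Finset.sum_eq_zero fun j _ => ?_
      rcases lt_or_ge l j with hlj | hjl
      · rw [hcomm k l j hlj v hv, if_neg hkl.ne', ih1 k l hkl v hv, sub_zero]
      · exact ih1 k j (hjl.trans_lt hkl) _ (hV j l v hv)
    · intro k v hv
      rw [hstep]
      set x := diagEigenvalue (fun k : Fin n => ν k - ((n : ℂ) - 1 - (k : ℕ))) with hx
      have hterm : ∀ j, ev ((E ^ p) k j (E j k v)) =
          (if k = j then x p k * ν k * ev v else 0) +
            ((if k < j then x p j else 0) - (if k < j then x p k else 0)) * ev v := by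
        intro j
        rcases lt_trichotomy k j with hkj | rfl | hjk
        · rw [hcomm k k j hkj v hv, ih2 j v hv, ih2 k v hv]
          simp [hkj, hkj.ne, sub_mul]
        · rw [ih2 k _ (hV k k v hv), hdiag k v hv]
          simp; ring
        · rw [ih1 k j hjk _ (hV j k v hv)]
          simp [hjk.ne', hjk.not_gt]
      -- Indices start at 0, so n - 1 - k of them exceed k. This count is the shift subtracted from
      -- ν_k.
      have hcard : (∑ j : Fin n, if k < j then x p k else 0) =
          ((n : ℂ) - 1 - (k : ℕ)) * x p k := by
        rw [← Finset.sum_filter, Finset.sum_const, Finset.filter_lt_eq_Ioi, Fin.card_Ioi,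
          nsmul_eq_mul, Nat.sub_sub, Nat.cast_sub (by omega)]
        push_cast; ring
      simp only [hterm, Finset.sum_add_distrib, ← Finset.sum_mul, Finset.sum_sub_distrib, hcard,
        Finset.sum_ite_eq, Finset.mem_univ, if_true]
      have : x (p + 1) k = (ν k - ((n : ℂ) - 1 - (k : ℕ))) * x p k +
          ∑ j, if k < j then x p j else 0 := rfl
      rw [this]; ring

/-! ### Power sums and the sums of the diagonal eigenvalues -/

lemma diagEigenvalue_succ {n : ℕ} (a : Fin (n + 1) → ℂ) (p : ℕ) (l : Fin n) :
    diagEigenvalue a p l.succ = diagEigenvalue (fun j => a j.succ) p l := by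
  induction p generalizing l with
  | zero => rfl
  | succ p ih =>
    rw [diagEigenvalue, diagEigenvalue, Fin.sum_univ_succ]
    simp [ih]

lemma diagEigenvalue_zero_step {n : ℕ} (a : Fin (n + 1) → ℂ) (p : ℕ) :
    diagEigenvalue a (p + 1) 0 =
      a 0 * diagEigenvalue a p 0 + ∑ j, diagEigenvalue (fun j => a j.succ) p j := by
  rw [diagEigenvalue, Fin.sum_univ_succ]
  simp [diagEigenvalue_succ]

/-- The sums of the `diagEigenvalue`s are the coefficients of `∏ (1 + 1 / (u - a i))`, so they
satisfy Newton-type identities. -/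
lemma sum_diagEigenvalue {n : ℕ} (a : Fin n → ℂ) :
    (∑ k, diagEigenvalue a 1 k = ((n : ℂ) ^ 2 + (2 * ∑ i, a i - n)) / 2) ∧
    (∑ k, diagEigenvalue a 2 k =
      (n * ∑ k, diagEigenvalue a 1 k + (2 * ∑ i, a i - n) * n
        + (3 * ∑ i, a i ^ 2 - 3 * ∑ i, a i + n)) / 3) ∧
    (∑ k, diagEigenvalue a 3 k =
      (n * ∑ k, diagEigenvalue a 2 k + (2 * ∑ i, a i - n) * ∑ k, diagEigenvalue a 1 k
        + (3 * ∑ i, a i ^ 2 - 3 * ∑ i, a i + n) * n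
        + (4 * ∑ i, a i ^ 3 - 6 * ∑ i, a i ^ 2 + 4 * ∑ i, a i - n)) / 4) ∧
    (∑ k, diagEigenvalue a 4 k =
      (n * ∑ k, diagEigenvalue a 3 k + (2 * ∑ i, a i - n) * ∑ k, diagEigenvalue a 2 k
        + (3 * ∑ i, a i ^ 2 - 3 * ∑ i, a i + n) * ∑ k, diagEigenvalue a 1 k
        + (4 * ∑ i, a i ^ 3 - 6 * ∑ i, a i ^ 2 + 4 * ∑ i, a i - n) * n
        + (5 * ∑ i, a i ^ 4 - 10 * ∑ i, a i ^ 3 + 10 * ∑ i, a i ^ 2 - 5 * ∑ i, a i + n)) / 5) := by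
  -- The brackets are Q_r = ∑ (a_i ^ r - (a_i - 1) ^ r), with Q_1 = n. They come from the
  -- logarithmic derivative of the product, which gives (p+1) S_p = Q_{p+1} + ∑_{q<p} Q_{p-q} S_q
  -- for the sums S_p. Removing the first variable leaves the other eigenvalues unchanged, so the
  -- induction reduces to polynomial identities.
  induction n with
  | zero => simp
  | succ n ih =>
    obtain ⟨h1, h2, h3, h4⟩ := ih fun j => a j.succ
    have h0 : ∑ k, diagEigenvalue (fun j => a j.succ) 0 k = (n : ℂ) := by simp [diagEigenvalue]
    have z0 : diagEigenvalue a 0 0 = 1 := rfl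
    have z1 := diagEigenvalue_zero_step a 0
    have z2 := diagEigenvalue_zero_step a 1
    have z3 := diagEigenvalue_zero_step a 2
    have z4 := diagEigenvalue_zero_step a 3
    simp only [zero_add, Nat.reduceAdd, h0, z0] at z1 z2 z3 z4
    simp only [Fin.sum_univ_succ, diagEigenvalue_succ, z4, z3, z2, z1, h4, h3, h2, h1]
    push_cast
    refine ⟨?_, ?_, ?_, ?_⟩ <;> ring

lemma sum_shifted_diagEigenvalue {n : ℕ} {α : Fin n → ℂ} (hα : ∑ i, α i = 0) :
    (∑ k, diagEigenvalue (fun i => α i - ((n : ℂ) - 1) / 2) 1 k = 0) ∧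
    (∑ k, diagEigenvalue (fun i => α i - ((n : ℂ) - 1) / 2) 2 k =
      (∑ l, α l ^ 2) - ((n : ℂ) ^ 3 - n) / 12) ∧
    (∑ k, diagEigenvalue (fun i => α i - ((n : ℂ) - 1) / 2) 3 k =
      (∑ l, α l ^ 3) - (n : ℂ) / 2 * (∑ l, α l ^ 2) + ((n : ℂ) ^ 4 - (n : ℂ) ^ 2) / 24) ∧
    (∑ k, diagEigenvalue (fun i => α i - ((n : ℂ) - 1) / 2) 4 k =
      (∑ l, α l ^ 4) - (n : ℂ) * (∑ l, α l ^ 3) + 1 / 2 * (∑ l, α l ^ 2)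
        - ((n : ℂ) ^ 5 - n) / 80) := by
  obtain ⟨h1, h2, h3, h4⟩ := sum_diagEigenvalue fun i => α i - ((n : ℂ) - 1) / 2
  set c : ℂ := ((n : ℂ) - 1) / 2 with hc
  have p1 : ∑ i, (α i - c) = -(n * c) := by simp [Finset.sum_sub_distrib, hα]
  have p2 : ∑ i, (α i - c) ^ 2 = ∑ i, α i ^ 2 + n * c ^ 2 := by
    have : ∀ i, (α i - c) ^ 2 = α i ^ 2 - 2 * c * α i + c ^ 2 := fun i => by ring
    simp [this, Finset.sum_add_distrib, Finset.sum_sub_distrib, ← Finset.mul_sum, hα]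
  have p3 : ∑ i, (α i - c) ^ 3 = ∑ i, α i ^ 3 - 3 * c * ∑ i, α i ^ 2 - n * c ^ 3 := by
    have : ∀ i, (α i - c) ^ 3 = α i ^ 3 - 3 * c * α i ^ 2 + 3 * c ^ 2 * α i - c ^ 3 :=
      fun i => by ring
    simp [this, Finset.sum_add_distrib, Finset.sum_sub_distrib, ← Finset.mul_sum, hα]
  have p4 : ∑ i, (α i - c) ^ 4 =
      ∑ i, α i ^ 4 - 4 * c * ∑ i, α i ^ 3 + 6 * c ^ 2 * ∑ i, α i ^ 2 + n * c ^ 4 := by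
    have : ∀ i, (α i - c) ^ 4 =
        α i ^ 4 - 4 * c * α i ^ 3 + 6 * c ^ 2 * α i ^ 2 - 4 * c ^ 3 * α i + c ^ 4 :=
      fun i => by ring
    simp [this, Finset.sum_add_distrib, Finset.sum_sub_distrib, ← Finset.mul_sum, hα]
  simp only [h4, h3, h2, h1, p1, p2, p3, p4]
  refine ⟨?_, ?_, ?_, ?_⟩ <;> rw [hc] <;> ring

/-! ### The Lie algebra action on smooth functions -/

section LieAction

variable {n : ℕ}

lemma diffOp_apply (X : Matrix (Fin n) (Fin n) ℝ) (F : SmoothFn n) (g : GL (Fin n) ℝ) :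
    (diffOp X F : GL (Fin n) ℝ → ℂ) g =
      fderiv ℝ (inCoords (F : GL (Fin n) ℝ → ℂ))
        (fun a b => (g : Matrix (Fin n) (Fin n) ℝ) a b)
        (mulRightCLM X (fun a b => (g : Matrix (Fin n) (Fin n) ℝ) a b)) :=
  rightDeriv_eq X F.2 g

lemma mulRightCLM_add (X Y : Matrix (Fin n) (Fin n) ℝ) (A : Fin n → Fin n → ℝ) :
    mulRightCLM (X + Y) A = mulRightCLM X A + mulRightCLM Y A := by
  ext a b
  change (Matrix.of A * (X + Y)) a b = (Matrix.of A * X) a b + (Matrix.of A * Y) a b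
  rw [Matrix.mul_add, Matrix.add_apply]

lemma mulRightCLM_smul (c : ℝ) (X : Matrix (Fin n) (Fin n) ℝ) (A : Fin n → Fin n → ℝ) :
    mulRightCLM (c • X) A = c • mulRightCLM X A := by
  ext a b
  change (Matrix.of A * (c • X)) a b = c • (Matrix.of A * X) a b
  rw [Matrix.mul_smul, Matrix.smul_apply]

lemma mulRightCLM_mul (X Y : Matrix (Fin n) (Fin n) ℝ) (A : Fin n → Fin n → ℝ) :
    mulRightCLM (X * Y) A = mulRightCLM Y (mulRightCLM X A) := by
  ext a b
  change (Matrix.of A * (X * Y)) a b = (Matrix.of A * X * Y) a b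
  rw [Matrix.mul_assoc]

/-- `X ↦ D_X` as a linear map. -/
noncomputable def diffOpLinear (n : ℕ) : Matrix (Fin n) (Fin n) ℝ →ₗ[ℝ] Module.End ℂ (SmoothFn n) where
  toFun := diffOp
  map_add' X Y := by
    ext F g
    change (diffOp (X + Y) F : GL (Fin n) ℝ → ℂ) g =
      (diffOp X F : GL (Fin n) ℝ → ℂ) g + (diffOp Y F : GL (Fin n) ℝ → ℂ) g
    simp only [diffOp_apply, mulRightCLM_add, map_add]
  map_smul' c X := by
    ext F g
    change (diffOp (c • X) F : GL (Fin n) ℝ → ℂ) g = c • (diffOp X F : GL (Fin n) ℝ → ℂ) g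
    simp only [diffOp_apply, mulRightCLM_smul, map_smul]

lemma diffOpLinear_apply (X : Matrix (Fin n) (Fin n) ℝ) : diffOpLinear n X = diffOp X := rfl

/-- The product rule for A ↦ DF(A)(AX) in the direction AY: the first-order term arises because the
vector field AX itself varies with A. -/
lemma diffOp_diffOp_apply (X Y : Matrix (Fin n) (Fin n) ℝ) (F : SmoothFn n)
    (g : GL (Fin n) ℝ) :
    (diffOp Y (diffOp X F) : GL (Fin n) ℝ → ℂ) g =
      fderiv ℝ (fderiv ℝ (inCoords (F : GL (Fin n) ℝ → ℂ)))
          (fun a b => (g : Matrix (Fin n) (Fin n) ℝ) a b)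
          (mulRightCLM Y (fun a b => (g : Matrix (Fin n) (Fin n) ℝ) a b))
          (mulRightCLM X (fun a b => (g : Matrix (Fin n) (Fin n) ℝ) a b)) +
        (diffOp (Y * X) F : GL (Fin n) ℝ → ℂ) g := by
  rw [diffOp_apply, diffOp_apply, mulRightCLM_mul]
  set A : Fin n → Fin n → ℝ := fun a b => (g : Matrix (Fin n) (Fin n) ℝ) a b
  have hA : invertibleSet n ∈ nhds A :=
    (isOpen_invertibleSet n).mem_nhds (coe_mem_invertibleSet g)
  have heq : inCoords (diffOp X F : GL (Fin n) ℝ → ℂ) =ᶠ[nhds A]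
      fun B => fderiv ℝ (inCoords (F : GL (Fin n) ℝ → ℂ)) B (mulRightCLM X B) := by
    filter_upwards [hA] with B hB
    obtain ⟨h, rfl⟩ := exists_coe_of_mem hB
    rw [inCoords_coe, diffOp_apply]
  have hd : HasFDerivAt (fderiv ℝ (inCoords (F : GL (Fin n) ℝ → ℂ)))
      (fderiv ℝ (fderiv ℝ (inCoords (F : GL (Fin n) ℝ → ℂ))) A) A := by
    have h1 : ContDiffOn ℝ ∞ (fderiv ℝ (inCoords (F : GL (Fin n) ℝ → ℂ))) (invertibleSet n) :=
      ContDiffOn.fderiv_of_isOpen F.2 (isOpen_invertibleSet n) (by simp)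
    exact ((h1.contDiffAt hA).differentiableAt (by simp)).hasFDerivAt
  rw [heq.fderiv_eq, (hd.clm_apply (mulRightCLM X).hasFDerivAt).fderiv]
  simp [add_comm]

/-- The second-derivative terms cancel by symmetry, leaving the first-order terms. -/
lemma diffOp_commutator (X Y : Matrix (Fin n) (Fin n) ℝ) :
    diffOp X * diffOp Y - diffOp Y * diffOp X = diffOp (X * Y - Y * X) := by
  rw [← diffOpLinear_apply (X * Y - Y * X), map_sub]
  ext F g
  have hsymm : IsSymmSndFDerivAt ℝ (inCoords (F : GL (Fin n) ℝ → ℂ))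
      (fun a b => (g : Matrix (Fin n) (Fin n) ℝ) a b) :=
    (ContDiffOn.contDiffAt F.2 ((isOpen_invertibleSet n).mem_nhds
      (coe_mem_invertibleSet g))).isSymmSndFDerivAt (by
      rw [minSmoothness_of_isRCLikeNormedField]; exact WithTop.coe_le_coe.mpr (le_top : (2 : ℕ∞) ≤ ⊤))
  change (diffOp X (diffOp Y F) : GL (Fin n) ℝ → ℂ) g -
      (diffOp Y (diffOp X F) : GL (Fin n) ℝ → ℂ) g =
    (diffOp (X * Y) F : GL (Fin n) ℝ → ℂ) g - (diffOp (Y * X) F : GL (Fin n) ℝ → ℂ) g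
  rw [diffOp_diffOp_apply, diffOp_diffOp_apply, hsymm.eq]
  ring

/-- The matrix with entries `D_{g⁻¹ E_{j,i} g}`. -/
noncomputable def conjGenerators (g : GL (Fin n) ℝ) : Matrix (Fin n) (Fin n) (Module.End ℂ (SmoothFn n)) :=
  Matrix.of fun i j => diffOp ((g⁻¹ : GL (Fin n) ℝ) * Matrix.single j i (1 : ℝ) *
    (g : Matrix (Fin n) (Fin n) ℝ))

/-- Conjugation by g⁻¹ preserves products of matrices, so the relations are those of the elementary
matrices with both index pairs transposed. -/
lemma isGLMatrix_conjGenerators (g : GL (Fin n) ℝ) : IsGLMatrix (conjGenerators g) := by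
  intro i j k l
  have hg : (g : Matrix (Fin n) (Fin n) ℝ) * (g⁻¹ : GL (Fin n) ℝ) = 1 := by
    rw [← Units.val_mul, mul_inv_cancel, Units.val_one]
  have hmul : ∀ X Y : Matrix (Fin n) (Fin n) ℝ,
      ((g⁻¹ : GL (Fin n) ℝ) : Matrix (Fin n) (Fin n) ℝ) * X * (g : Matrix (Fin n) (Fin n) ℝ) *
        ((g⁻¹ : GL (Fin n) ℝ) * Y * (g : Matrix (Fin n) (Fin n) ℝ)) =
      (g⁻¹ : GL (Fin n) ℝ) * (X * Y) * (g : Matrix (Fin n) (Fin n) ℝ) := fun X Y => by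
    calc _ = ((g⁻¹ : GL (Fin n) ℝ) : Matrix (Fin n) (Fin n) ℝ) * X *
          ((g : Matrix (Fin n) (Fin n) ℝ) * (g⁻¹ : GL (Fin n) ℝ)) * Y *
            (g : Matrix (Fin n) (Fin n) ℝ) := by simp only [Matrix.mul_assoc]
      _ = _ := by rw [hg]; simp only [Matrix.mul_assoc, Matrix.one_mul]
  simp only [conjGenerators, Matrix.of_apply]
  rw [diffOp_commutator, hmul, hmul, ← diffOpLinear_apply, map_sub]
  congr 1
  · split_ifs with h
    · subst h; simp [diffOpLinear_apply]
    · rw [Matrix.single_mul_single_of_ne _ _ _ _ h]; simp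
  · split_ifs with h
    · subst h; simp [diffOpLinear_apply]
    · rw [Matrix.single_mul_single_of_ne _ _ _ _ (Ne.symm h)]; simp

/-- The trace is not cyclic over a noncommutative ring, but here the entries being moved are real
scalars, which are central. -/
lemma trace_map_conj {A : Type*} [Semiring A] [Algebra ℝ A] {P Q : Matrix (Fin n) (Fin n) ℝ}
    (hQP : Q * P = 1) (N : Matrix (Fin n) (Fin n) A) :
    (P.map (algebraMap ℝ A) * N * Q.map (algebraMap ℝ A)).trace = N.trace := by
  have hterm : ∀ i b a, algebraMap ℝ A (P i a) * N a b * algebraMap ℝ A (Q b i) =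
      N a b * algebraMap ℝ A (Q b i * P i a) := fun i b a => by
    rw [Algebra.commutes, mul_assoc, ← map_mul, mul_comm (P i a)]
  simp only [Matrix.trace, Matrix.diag_apply, Matrix.mul_apply, Matrix.map_apply, Finset.sum_mul,
    hterm]
  rw [Finset.sum_comm]
  refine Finset.sum_congr rfl fun b _ => ?_
  rw [Finset.sum_comm]
  simp only [← Finset.mul_sum, ← map_sum, ← Matrix.mul_apply, hQP, Matrix.one_apply]
  simp

lemma conjGenerators_eq (g : GL (Fin n) ℝ) :
    conjGenerators g = (g : Matrix (Fin n) (Fin n) ℝ).map (algebraMap ℝ _) * conjGenerators 1 *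
      ((g⁻¹ : GL (Fin n) ℝ) : Matrix (Fin n) (Fin n) ℝ).map (algebraMap ℝ _) := by
  ext1 i j
  have hsum : ((g⁻¹ : GL (Fin n) ℝ) : Matrix (Fin n) (Fin n) ℝ) * Matrix.single j i (1 : ℝ) *
      (g : Matrix (Fin n) (Fin n) ℝ) = ∑ b, ∑ a,
        ((g⁻¹ : GL (Fin n) ℝ) b j * g i a) • Matrix.single b a (1 : ℝ) := by
    rw [Matrix.matrix_eq_sum_single (_ * _ * _)]
    refine Finset.sum_congr rfl fun b _ => Finset.sum_congr rfl fun a _ => ?_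
    rw [Matrix.smul_single, smul_eq_mul, mul_one]
    congr 1
    rw [Matrix.mul_assoc, Matrix.mul_apply, Finset.sum_eq_single j]
    · simp
    · intro c _ hc
      simp [Matrix.single_mul_apply_of_ne, hc]
    · simp
  rw [conjGenerators, Matrix.of_apply, hsum, ← diffOpLinear_apply, Matrix.mul_apply]
  simp only [map_sum, map_smul, Matrix.mul_apply, Matrix.map_apply, Finset.sum_mul]
  refine Finset.sum_congr rfl fun b _ => Finset.sum_congr rfl fun a _ => ?_
  rw [Algebra.commutes, mul_assoc, ← map_mul, ← Algebra.commutes, ← Algebra.smul_def, mul_comm]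
  simp [conjGenerators, diffOpLinear_apply]

/-- This allows a different frame of generators at each point g when the Casimir operator is
evaluated there. -/
lemma trace_conjGenerators_pow (g : GL (Fin n) ℝ) (m : ℕ) :
    (conjGenerators g ^ m).trace = (conjGenerators 1 ^ m).trace := by
  have hg : ((g⁻¹ : GL (Fin n) ℝ) : Matrix (Fin n) (Fin n) ℝ) * g = 1 := by
    rw [← Units.val_mul, inv_mul_cancel, Units.val_one]
  have hg' : (g : Matrix (Fin n) (Fin n) ℝ) * (g⁻¹ : GL (Fin n) ℝ) = 1 := by
    rw [← Units.val_mul, mul_inv_cancel, Units.val_one]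
  have hpow : conjGenerators g ^ m =
      (g : Matrix (Fin n) (Fin n) ℝ).map (algebraMap ℝ _) * conjGenerators 1 ^ m *
        ((g⁻¹ : GL (Fin n) ℝ) : Matrix (Fin n) (Fin n) ℝ).map (algebraMap ℝ _) := by
    induction m with
    | zero =>
      rw [pow_zero, pow_zero, Matrix.mul_one, ← Matrix.map_mul, hg',
        Matrix.map_one _ (map_zero _) (map_one _)]
    | succ m ih =>
      rw [pow_succ, ih, conjGenerators_eq g]
      set P := (g : Matrix (Fin n) (Fin n) ℝ).map (algebraMap ℝ (Module.End ℂ (SmoothFn n)))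
      set Q := ((g⁻¹ : GL (Fin n) ℝ) : Matrix (Fin n) (Fin n) ℝ).map
        (algebraMap ℝ (Module.End ℂ (SmoothFn n)))
      have hQP : Q * P = 1 := by
        rw [← Matrix.map_mul, hg, Matrix.map_one _ (map_zero _) (map_one _)]
      calc _ = P * conjGenerators 1 ^ m * (Q * P) * conjGenerators 1 * Q := by
            simp only [Matrix.mul_assoc]
        _ = _ := by rw [hQP, Matrix.mul_one, pow_succ]; simp only [Matrix.mul_assoc]
  rw [hpow]
  exact trace_map_conj hg _

lemma conjGenerators_one_apply (i j : Fin n) :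
    conjGenerators 1 i j = diffOp (Matrix.single j i (1 : ℝ)) := by
  simp [conjGenerators]

end LieAction

/-! ### Casimir operators -/

section Casimir

lemma sum_fin_succ_fun {α β : Type*} [Fintype α] [AddCommMonoid β] {m : ℕ}
    (f : (Fin (m + 1) → α) → β) :
    ∑ i, f i = ∑ a, ∑ v : Fin m → α, f (Matrix.vecCons a v) := by
  rw [← (Fin.consEquiv fun _ => α).sum_comp, Fintype.sum_prod_type]
  rfl

/-- With transposed indices, the chain in composition order is the closed path i_1 → i_m → ⋯ → i_2 →
i_1 of a matrix power. The two sides differ only in the order of the summations. -/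
lemma casimir_eq_trace {n m : ℕ} (hm : 1 ≤ m) (hm4 : m ≤ 4) :
    casimir m n = (conjGenerators (n := n) 1 ^ m).trace := by
  interval_cases m
  · simp [casimir, elementaryOp, sum_fin_succ_fun, Matrix.trace, conjGenerators_one_apply]
  · simp [casimir, elementaryOp, sum_fin_succ_fun, Matrix.trace, conjGenerators_one_apply,
      pow_succ', Matrix.mul_apply]
  · simp [casimir, elementaryOp, sum_fin_succ_fun, Matrix.trace, conjGenerators_one_apply,
      pow_succ', Matrix.mul_apply, Finset.mul_sum]
    exact Finset.sum_congr rfl fun _ _ => Finset.sum_comm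
  · simp [casimir, elementaryOp, sum_fin_succ_fun, Matrix.trace, conjGenerators_one_apply,
      pow_succ', Matrix.mul_apply, Finset.mul_sum]
    refine Finset.sum_congr rfl fun _ _ => ?_
    refine (Finset.sum_congr rfl fun _ _ => Finset.sum_comm).trans ?_
    exact Finset.sum_comm.trans (Finset.sum_congr rfl fun _ _ => Finset.sum_comm)

lemma casimir_mem_invariantOps {n m : ℕ} (hm : 1 ≤ m) (hm4 : m ≤ 4) :
    casimir m n ∈ invariantOps n := by
  refine ⟨Subalgebra.sum_mem _ fun i _ => Subalgebra.list_prod_mem _ fun T hT => ?_, ?_⟩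
  · rw [List.mem_reverse, List.mem_ofFn] at hT
    obtain ⟨j, rfl⟩ := hT
    exact Algebra.subset_adjoin ⟨_, rfl⟩
  -- It suffices to commute with the elementary generators, since the centralizer of the Casimir
  -- operator is a subalgebra.
  · have hle : envelopingAlg n ≤ Subalgebra.centralizer ℝ {casimir m n} := by
      refine Algebra.adjoin_le ?_
      rintro _ ⟨X, rfl⟩
      have hX : diffOp X = ∑ i, ∑ j, X i j • diffOp (Matrix.single i j (1 : ℝ)) := by
        conv_lhs => rw [Matrix.matrix_eq_sum_single X, ← diffOpLinear_apply]
        simp only [map_sum]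
        refine Finset.sum_congr rfl fun i _ => Finset.sum_congr rfl fun j _ => ?_
        rw [← diffOpLinear_apply, ← map_smul, Matrix.smul_single, smul_eq_mul, mul_one]
      simp only [hX]
      refine Subalgebra.sum_mem _ fun i _ => Subalgebra.sum_mem _ fun j _ =>
        Subalgebra.smul_mem _ ?_ _
      rw [Subalgebra.mem_centralizer_iff]
      rintro _ rfl
      rw [casimir_eq_trace hm hm4, ← conjGenerators_one_apply]
      exact ((isGLMatrix_conjGenerators 1).commute_trace_pow m j i).eq.symm
    rw [SetLike.mem_coe, Subalgebra.mem_centralizer_iff]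
    intro T hT
    exact (Subalgebra.mem_centralizer_iff ℝ |>.mp (hle hT) _ rfl).symm

end Casimir

/-! ### Functions equivariant under the Borel subgroup -/

section Equivariant

variable {n : ℕ}

/-- The smooth functions `G` with `G (b g) = ∏ b_{ii} ^ ν_i * G g` for all upper triangular `b`
with positive diagonal. -/
def equivariantFns (ν : Fin n → ℂ) : Submodule ℂ (SmoothFn n) where
  carrier := {G | ∀ b g : GL (Fin n) ℝ, (∀ i j, j < i → (b : Matrix (Fin n) (Fin n) ℝ) i j = 0) →
    (∀ i, 0 < (b : Matrix (Fin n) (Fin n) ℝ) i i) →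
    (G : GL (Fin n) ℝ → ℂ) (b * g) =
      (∏ i, (((b : Matrix (Fin n) (Fin n) ℝ) i i : ℝ) : ℂ) ^ ν i) * (G : GL (Fin n) ℝ → ℂ) g}
  zero_mem' := fun b g _ _ => by simp
  add_mem' := fun {F G} hF hG b g hb hpos => by
    change (F : GL (Fin n) ℝ → ℂ) (b * g) + (G : GL (Fin n) ℝ → ℂ) (b * g) =
      _ * ((F : GL (Fin n) ℝ → ℂ) g + (G : GL (Fin n) ℝ → ℂ) g)
    rw [hF b g hb hpos, hG b g hb hpos, mul_add]
  smul_mem' := fun c F hF b g hb hpos => by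
    change c * (F : GL (Fin n) ℝ → ℂ) (b * g) = _ * (c * (F : GL (Fin n) ℝ → ℂ) g)
    rw [hF b g hb hpos, mul_left_comm]

/-- D_X is built from right translations, which commute with the left translations defining
equivariance. -/
lemma diffOp_mem_equivariantFns {ν : Fin n → ℂ} (X : Matrix (Fin n) (Fin n) ℝ) {G : SmoothFn n}
    (hG : G ∈ equivariantFns ν) : diffOp X G ∈ equivariantFns ν := by
  intro b g hb hpos
  change rightDeriv X G (b * g) = _ * rightDeriv X G g
  rw [rightDeriv, rightDeriv, ← deriv_const_mul_field]
  refine Filter.EventuallyEq.deriv_eq ?_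
  filter_upwards [eventually_mem_invertibleSet X g] with t ht
  obtain ⟨g', hg'⟩ := exists_coe_of_mem ht
  have hbg : (fun i j => (((b * g : GL (Fin n) ℝ) : Matrix (Fin n) (Fin n) ℝ) * (1 + t • X)) i j) =
      fun i j => ((b * g' : GL (Fin n) ℝ) : Matrix (Fin n) (Fin n) ℝ) i j := by
    have : (g' : Matrix (Fin n) (Fin n) ℝ) = g * (1 + t • X) := hg'
    rw [Units.val_mul, Units.val_mul, this, Matrix.mul_assoc]
  rw [hbg, ← hg', inCoords_coe, inCoords_coe, hG b g' hb hpos]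

/-- Since g(1 + t g⁻¹Xg) = (1 + tX)g, the conjugated direction is a left translation. For X =
E_{j,i} with j ≤ i the factor 1 + tX is upper triangular, so equivariance applies. -/
lemma eventually_inCoords_conj {ν : Fin n → ℂ} {G : SmoothFn n} (hG : G ∈ equivariantFns ν)
    (g : GL (Fin n) ℝ) {i j : Fin n} (hji : j ≤ i) :
    ∀ᶠ t : ℝ in nhds 0, inCoords (G : GL (Fin n) ℝ → ℂ)
        (fun a b => ((g : Matrix (Fin n) (Fin n) ℝ) * (1 + t • (((g⁻¹ : GL (Fin n) ℝ) : Matrix (Fin n) (Fin n) ℝ) *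
          Matrix.single j i (1 : ℝ) * (g : Matrix (Fin n) (Fin n) ℝ)))) a b) =
      (if i = j then ((1 + t : ℝ) : ℂ) ^ ν i else 1) * (G : GL (Fin n) ℝ → ℂ) g := by
  -- The bound t > -1 keeps the diagonal of 1 + tE_{j,i} positive, also when i = j.
  filter_upwards [eventually_mem_invertibleSet (((g⁻¹ : GL (Fin n) ℝ) : Matrix (Fin n) (Fin n) ℝ) *
    Matrix.single j i (1 : ℝ) * (g : Matrix (Fin n) (Fin n) ℝ)) g,
    eventually_gt_nhds (show (-1 : ℝ) < 0 by norm_num)] with t ht ht1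
  obtain ⟨g', hg'⟩ := exists_coe_of_mem ht
  have hgg : (g : Matrix (Fin n) (Fin n) ℝ) * (g⁻¹ : GL (Fin n) ℝ) = 1 := by
    rw [← Units.val_mul, mul_inv_cancel, Units.val_one]
  have hval : (g' : Matrix (Fin n) (Fin n) ℝ) =
      (1 + t • Matrix.single j i (1 : ℝ)) * (g : Matrix (Fin n) (Fin n) ℝ) := by
    have h1 : (g' : Matrix (Fin n) (Fin n) ℝ) = (g : Matrix (Fin n) (Fin n) ℝ) *
      (1 + t • (((g⁻¹ : GL (Fin n) ℝ) : Matrix (Fin n) (Fin n) ℝ) *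
        Matrix.single j i (1 : ℝ) * (g : Matrix (Fin n) (Fin n) ℝ))) := hg'
    rw [h1, Matrix.mul_add, Matrix.add_mul, Matrix.mul_one, Matrix.one_mul, Matrix.mul_smul,
      Matrix.smul_mul, ← Matrix.mul_assoc, ← Matrix.mul_assoc, hgg, Matrix.one_mul]
  set b : GL (Fin n) ℝ := g' * g⁻¹ with hb
  have hbval : (b : Matrix (Fin n) (Fin n) ℝ) = 1 + t • Matrix.single j i (1 : ℝ) := by
    rw [hb, Units.val_mul, hval, Matrix.mul_assoc, hgg, Matrix.mul_one]
  have hbg : g' = b * g := by simp [hb]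
  have hentry : ∀ k l, (b : Matrix (Fin n) (Fin n) ℝ) k l =
      (if k = l then 1 else 0) + if j = k ∧ i = l then t else 0 := fun k l => by
    rw [hbval]
    simp [Matrix.one_apply, Matrix.single_apply]
  rw [← hg', inCoords_coe, hbg, hG b g]
  · congr 1
    split_ifs with hij
    · subst hij
      rw [Finset.prod_eq_single i]
      · simp [hentry]
      · intro k _ hk
        simp [hentry, Ne.symm hk]
      · simp
    · refine Finset.prod_eq_one fun k _ => ?_
      have : ¬ (j = k ∧ i = k) := fun h => hij (h.2.trans h.1.symm)
      simp [hentry, this]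
  · intro k l hlk
    have : ¬ (j = k ∧ i = l) := by
      rintro ⟨rfl, rfl⟩
      exact absurd hji (not_le.mpr hlk)
    simp [hentry, hlk.ne', this]
  · intro k
    rw [hentry, if_pos rfl]
    split_ifs <;> linarith

lemma conjGenerators_apply_of_lt {ν : Fin n → ℂ} {G : SmoothFn n} (hG : G ∈ equivariantFns ν)
    (g : GL (Fin n) ℝ) {i j : Fin n} (hji : j < i) :
    (conjGenerators g i j G : GL (Fin n) ℝ → ℂ) g = 0 := by
  change rightDeriv _ _ g = 0
  rw [rightDeriv, Filter.EventuallyEq.deriv_eq (eventually_inCoords_conj hG g hji.le)]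
  simp [hji.ne']

lemma conjGenerators_apply_diag {ν : Fin n → ℂ} {G : SmoothFn n} (hG : G ∈ equivariantFns ν)
    (g : GL (Fin n) ℝ) (i : Fin n) :
    (conjGenerators g i i G : GL (Fin n) ℝ → ℂ) g = ν i * (G : GL (Fin n) ℝ → ℂ) g := by
  change rightDeriv _ _ g = _
  rw [rightDeriv, Filter.EventuallyEq.deriv_eq (eventually_inCoords_conj hG g le_rfl)]
  simp only [if_true]
  have h1 : HasDerivAt (fun z : ℂ => (1 + z) ^ ν i) (ν i) ((0 : ℝ) : ℂ) := by
    have h := ((hasDerivAt_id (0 : ℂ)).const_add 1).cpow_const (c := ν i) (by simp)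
    simpa using h
  have h2 := h1.comp_ofReal.mul_const ((G : GL (Fin n) ℝ → ℂ) g)
  simpa using h2.deriv

/-! ### Equivariance of the power function -/

/-- Rows of `b` from index i on vanish in the columns before i, so no earlier row of `N` enters. -/
lemma submatrix_mul_of_upperTriangular {b : Matrix (Fin n) (Fin n) ℝ}
    (hb : ∀ i j, j < i → b i j = 0) (N : Matrix (Fin n) (Fin n) ℝ) (i : ℕ) {κ : Type*}
    (f : κ → Fin n) :
    (b * N).submatrix (Subtype.val : {j : Fin n // i ≤ j.val} → Fin n) f =
      b.submatrix (Subtype.val : {j : Fin n // i ≤ j.val} → Fin n)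
          (Subtype.val : {j : Fin n // i ≤ j.val} → Fin n) *
        N.submatrix (Subtype.val : {j : Fin n // i ≤ j.val} → Fin n) f := by
  ext a c
  rw [Matrix.submatrix_apply, Matrix.mul_apply, Matrix.mul_apply]
  symm
  refine Finset.sum_of_injOn Subtype.val Subtype.val_injective.injOn
    (fun _ _ => Finset.mem_univ _) ?_ fun _ _ => rfl
  intro j _ hj
  have hja : j < a.val := by
    by_contra hlt
    exact hj ⟨⟨j, le_trans a.2 (not_lt.mp hlt)⟩, by simp, rfl⟩
  rw [hb _ _ hja, zero_mul]

lemma cornerMinor_mul_left {b : Matrix (Fin n) (Fin n) ℝ} (hb : ∀ i j, j < i → b i j = 0)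
    (A : Matrix (Fin n) (Fin n) ℝ) (i : ℕ) :
    cornerMinor (b * A) i =
      (∏ j : {j : Fin n // i ≤ j.val}, b j j) ^ 2 * cornerMinor A i := by
  have hdet : (b.submatrix (Subtype.val : {j : Fin n // i ≤ j.val} → Fin n) Subtype.val).det =
      ∏ j : {j : Fin n // i ≤ j.val}, b j j := by
    rw [Matrix.det_of_isUpperTriangular]
    · simp
    · intro a c hac
      exact hb _ _ hac
  -- Symmetry of A Aᵀ puts both factors `b` on the left, up to a transpose, so the row factorization
  -- can be used twice.
  have h1 : b * A * (b * A)ᵀ = b * (b * (A * Aᵀ))ᵀ := by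
    simp only [Matrix.transpose_mul, Matrix.transpose_transpose, Matrix.mul_assoc]
  rw [cornerMinor, h1, submatrix_mul_of_upperTriangular hb, ← Matrix.transpose_submatrix,
    submatrix_mul_of_upperTriangular hb, Matrix.det_mul, Matrix.det_transpose, Matrix.det_mul, hdet,
    cornerMinor]
  ring

/-- Consecutive corner minors acquire squared products of diagonal entries that differ by the single
factor `b i i ^ 2`. -/
lemma iwasawaY_mul_left {b : Matrix (Fin n) (Fin n) ℝ} (hb : ∀ i j, j < i → b i j = 0)
    (hpos : ∀ i, 0 < b i i) (A : Matrix (Fin n) (Fin n) ℝ) (i : Fin n) :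
    iwasawaY (b * A) i = b i i * iwasawaY A i := by
  have key : ∏ j : {j : Fin n // (i : ℕ) ≤ j.val}, b j j =
      b i i * ∏ j : {j : Fin n // (i : ℕ) + 1 ≤ j.val}, b j j := by
    rw [← Finset.prod_subtype (Finset.univ.filter fun j : Fin n => (i : ℕ) ≤ j.val)
        (by simp) (fun j => b j j),
      ← Finset.prod_subtype (Finset.univ.filter fun j : Fin n => (i : ℕ) + 1 ≤ j.val)
        (by simp) (fun j => b j j),
      ← Finset.prod_insert (f := fun j => b j j) (a := i)
        (s := Finset.univ.filter fun j : Fin n => (i : ℕ) + 1 ≤ j.val) (by simp)]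
    refine Finset.prod_congr ?_ fun _ _ => rfl
    ext j
    simp only [Finset.mem_filter, Finset.mem_univ, true_and, Finset.mem_insert, Fin.ext_iff]
    omega
  have hP : 0 < ∏ j : {j : Fin n // (i : ℕ) + 1 ≤ j.val}, b j j :=
    Finset.prod_pos fun j _ => hpos _
  rw [iwasawaY, iwasawaY, cornerMinor_mul_left hb, cornerMinor_mul_left hb, key, mul_pow,
    mul_comm (b i i ^ 2), mul_assoc, mul_div_mul_left _ _ (pow_pos hP 2).ne', mul_div_assoc,
    Real.sqrt_mul (sq_nonneg _), Real.sqrt_sq (hpos i).le]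

lemma power_mem_equivariantFns (ν : Fin n → ℂ) : power ν ∈ equivariantFns ν := by
  intro b g hb hpos
  change powerFun ν (b * g) = _ * powerFun ν g
  rw [powerFun, powerFun, ← Finset.prod_mul_distrib]
  refine Finset.prod_congr rfl fun i _ => ?_
  rw [Units.val_mul, iwasawaY_mul_left hb hpos, Complex.ofReal_mul]
  exact Complex.mul_cpow_ofReal_nonneg (hpos i).le (Real.sqrt_nonneg _) _

/-- Evaluation of smooth functions at a point. -/
def evalAt (g : GL (Fin n) ℝ) : SmoothFn n →ₗ[ℂ] ℂ :=
  (LinearMap.proj g).comp (SmoothFn n).subtype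

lemma casimir_power {m : ℕ} (hm : 1 ≤ m) (hm4 : m ≤ 4) (α : Fin n → ℂ) :
    casimir m n (power fun i => α i + rhoShift n i) =
      (∑ k, diagEigenvalue (fun i => α i - ((n : ℂ) - 1) / 2) m k) •
        power fun i => α i + rhoShift n i := by
  ext g
  rw [casimir_eq_trace hm hm4, ← trace_conjGenerators_pow g]
  set ν : Fin n → ℂ := fun i => α i + rhoShift n i with hν
  -- Here ρ_k = (n-1)/2 - k with k counted from 0, so the dependence on k cancels and the shift is
  -- the same constant for all indices.
  have hshift : (fun k : Fin n => ν k - ((n : ℂ) - 1 - (k : ℕ))) =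
      fun i => α i - ((n : ℂ) - 1) / 2 := by
    funext k
    simp only [hν, rhoShift]
    ring
  have h := ((isGLMatrix_conjGenerators g).pow_apply_of_highestWeight (V := equivariantFns ν)
    (fun i j v hv => diffOp_mem_equivariantFns _ hv) (evalAt g) ν
    (fun i j hji v hv => conjGenerators_apply_of_lt hv g hji)
    (fun i v hv => conjGenerators_apply_diag hv g i) m).2
  rw [hshift] at h
  change evalAt g ((conjGenerators g ^ m).trace (power ν)) = _ * evalAt g (power ν)
  rw [Matrix.trace, LinearMap.sum_apply, map_sum, Finset.sum_mul]
  exact Finset.sum_congr rfl fun k _ => h k _ (power_mem_equivariantFns ν)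

end Equivariant

end GLMaass

theorem theorem1p1 (n : ℕ) (hn : 2 ≤ n) (φ : GLMaass.SmoothFn n) (hφ : GLMaass.IsMaassForm φ)
    (α : Fin n → ℂ) (hα : GLMaass.HasLanglandsParameters φ α)
    (m : ℕ) (hm : 1 ≤ m) (hmn : m ≤ n) :
    (m = 1 → GLMaass.casimir m n φ = 0) ∧
    (m = 2 → GLMaass.casimir m n φ =
      ((∑ l, α l ^ 2) - ((n : ℂ) ^ 3 - n) / 12) • φ) ∧
    (m = 3 → GLMaass.casimir m n φ =
      ((∑ l, α l ^ 3) - (n : ℂ) / 2 * (∑ l, α l ^ 2) + ((n : ℂ) ^ 4 - (n : ℂ) ^ 2) / 24) • φ) ∧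
    (m = 4 → GLMaass.casimir m n φ =
      ((∑ l, α l ^ 4) - (n : ℂ) * (∑ l, α l ^ 3) + 1 / 2 * (∑ l, α l ^ 2)
        - ((n : ℂ) ^ 5 - n) / 80) • φ) := by
  -- The eigenvalue on the power function passes to φ by the definition of Langlands parameters.
  have key : m ≤ 4 → GLMaass.casimir m n φ =
      (∑ k, GLMaass.diagEigenvalue (fun i => α i - ((n : ℂ) - 1) / 2) m k) • φ := fun hm4 =>
    hα.2 _ (GLMaass.casimir_mem_invariantOps hm hm4) _ (GLMaass.casimir_power hm hm4 α)
  obtain ⟨h1, h2, h3, h4⟩ := GLMaass.sum_shifted_diagEigenvalue hα.1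
  refine ⟨?_, ?_, ?_, ?_⟩ <;> rintro rfl
  · rw [key (by norm_num), h1, zero_smul]
  · rw [key (by norm_num), h2]
  · rw [key (by norm_num), h3]
  · rw [key (by norm_num), h4]
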